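/- Let $N\ge 2$ be an integer and $a>0$ a real number. For $j\ge 0$ let $c_j$ be the surface area of the unit sphere $S^j\subset\mathbb R^{j+1}$, and let $S^{N-1}(a)\subset\mathbb R^N$ be the sphere of radius $a$ centred at $0$, with its uniform probability measure $\bar\sigma$. For $m\ge 0$, a *monic zonal harmonic polynomial of degree $m$* is a monic polynomial $q_m\in\mathbb C[X]$ of degree $m$ such that the harmonic polynomial $L_a q_m(X_1)\in\mathbb C[X_1,\dots,X_N]$, i.e. the unique polynomial annihilated by $\sum_{j=1}^N\partial_j^2$ that coincides with $q_m(X_1)$ at every point of $S^{N-1}(a)$, is homogeneous of degree $m$. For $p,q\in\mathbb C[X]$ put $$\langle p,q\rangle_{a,N}=\int_{S^{N-1}(a)}p(x_1)\overline{q(x_1)}\,d\bar\sigma(x).$$ Then, for all $p,q\in\mathbb C[X]$, $$\langle p,q\rangle_{a,N}=\frac{c_{N-2}}{c_{N-1}\,a}\int_{-a}^{a}p(x)\overline{q(x)}\left(1-\frac{x^2}{a^2}\right)^{\frac{N-3}{2}}dx ,$$ this is an inner product on $\mathbb C[X]$, and for every $m\ge0$ there is exactly one monic zonal harmonic polynomial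 $q_m$ of degree $m$, namely the $m$-th vector obtained from $1,X,X^2,\dots$ by Gram–Schmidt orthogonalization without normalization: $q_m$ is the component of $X^m$ orthogonal, with respect to $\langle\cdot,\cdot\rangle_{a,N}$, to the span of $1,X,\dots,X^{m-1}$. -/

import Mathlib

open MeasureTheory
open scoped Polynomial ComplexConjugate

noncomputable section

/-- The surface area `c_j` of the unit sphere `S^j` in `ℝ^(j+1)`: the total mass of the
surface measure on the unit sphere. -/
def sphereArea (j : ℕ) : ℝ :=
  (volume : Measure (EuclideanSpace ℝ (Fin (j + 1)))).toSphere.real Set.univ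

/-- The uniform measure of total mass `1` on the sphere `S^(N-1)(a)` of radius `a` and centre `0`,
as a measure on `ℝ^N`: the image under `x ↦ a x` of the normalized surface measure of the
unit sphere. -/
def uniformSphere (N : ℕ) (a : ℝ) : Measure (EuclideanSpace ℝ (Fin N)) :=
  ((volume : Measure (EuclideanSpace ℝ (Fin N))).toSphere Set.univ)⁻¹ •
    (volume : Measure (EuclideanSpace ℝ (Fin N))).toSphere.map
      (fun x : Metric.sphere (0 : EuclideanSpace ℝ (Fin N)) 1 =>
        a • (x : EuclideanSpace ℝ (Fin N)))

/-- The value of a complex polynomial in `N` variables at a point of `ℝ^N`. -/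
def evalReal {N : ℕ} (p : MvPolynomial (Fin N) ℂ) (x : EuclideanSpace ℝ (Fin N)) : ℂ :=
  MvPolynomial.eval (fun i => ((x i : ℝ) : ℂ)) p

/-- The Laplacian `∂_1^2 + ⋯ + ∂_N^2` on `ℂ[X_1, …, X_N]`. -/
def laplacianPoly {N : ℕ} (p : MvPolynomial (Fin N) ℂ) : MvPolynomial (Fin N) ℂ :=
  ∑ i, MvPolynomial.pderiv i (MvPolynomial.pderiv i p)

/-- The polynomial `q(X_1)`, as an element of `ℂ[X_1, …, X_N]`. -/
def inFirstVariable (N : ℕ) [NeZero N] (q : ℂ[X]) : MvPolynomial (Fin N) ℂ :=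
  Polynomial.aeval (MvPolynomial.X (0 : Fin N)) q

/-- `h = L_a p`: `h` is the harmonic polynomial that agrees with `p` on the sphere of radius `a`
about the origin. -/
def IsHarmonicRestriction {N : ℕ} (a : ℝ) (p h : MvPolynomial (Fin N) ℂ) : Prop :=
  laplacianPoly h = 0 ∧
    ∀ x ∈ Metric.sphere (0 : EuclideanSpace ℝ (Fin N)) a, evalReal h x = evalReal p x

/-- `q` is the monic zonal harmonic polynomial `q_m(a; X)`: it is monic of degree `m`, and the
harmonic polynomial `L_a q(X_1)` is homogeneous of degree `m`. -/
def IsZonalPolynomial (N : ℕ) [NeZero N] (a : ℝ) (m : ℕ) (q : ℂ[X]) : Prop :=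
  q.Monic ∧ q.natDegree = m ∧
    ∃ h : MvPolynomial (Fin N) ℂ,
      IsHarmonicRestriction a (inFirstVariable N q) h ∧ h.IsHomogeneous m

/-- The pairing `⟨p, q⟩_{a,N}`, the mean of `p q̄` over the sphere `S^(N-1)(a)`. -/
def spherePairing {N : ℕ} (a : ℝ) (p q : MvPolynomial (Fin N) ℂ) : ℂ :=
  ∫ x, evalReal p x * conj (evalReal q x) ∂(uniformSphere N a)

/-- The one-variable pairing
`(c_{N-2} / (c_{N-1} a)) ∫_{-a}^a p(x) q̄(x) (1 - x²/a²)^((N-3)/2) dx`, for `N ≥ 2`. -/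
def weightPairing (N : ℕ) (a : ℝ) (p q : ℂ[X]) : ℂ :=
  ((sphereArea (N - 2) / (sphereArea (N - 1) * a) : ℝ) : ℂ) *
    ∫ x in (-a)..a, p.eval (x : ℂ) * conj (q.eval (x : ℂ)) *
      (((1 - x ^ 2 / a ^ 2) ^ (((N : ℝ) - 3) / 2) : ℝ) : ℂ)

/-- The (unnormalized) Gram–Schmidt process for a sequence of vectors of a complex vector space,
with respect to the inner product `c`. -/
def gramSchmidtOf {V : Type*} [AddCommGroup V] [Module ℂ V] (c : InnerProductSpace.Core ℂ V)
    (f : ℕ → V) : ℕ → V :=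
  letI : NormedAddCommGroup V := c.toNormedAddCommGroup
  letI : InnerProductSpace ℂ V := InnerProductSpace.ofCore c.toCore
  InnerProductSpace.gramSchmidt ℂ f

end

/-! On the sphere a zonal polynomial of degree m agrees with a homogeneous harmonic h of degree m,
and h is orthogonal there to x_1^k for k < m. A monic polynomial with this orthogonality is the
Gram–Schmidt vector. So a zonal polynomial is unique if it exists, and existence in every degree
gives the converse.

Orthogonality is proved with Gaussian integrals. For a homogeneous integrand, integration over the
unit sphere is integration over ℝ^N against exp(-|x|²), up to a nonzero Gamma factor
(`gaussIntegral_eq_integral_sphere`). Under the Gaussian integral, multiplication by x_i may be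
traded for ∂_i / 2 (`gaussIntegral_X_mul`); with Euler's identity this gives
`gaussIntegral_harmonic_mul_X_pow`. The same reduction evaluates the moments of x_1 on the sphere as
Beta values, which are also the moments of the weight; linearity then gives the integral formula.

Existence comes from a three-term recursion (`ZonalHarmonicPair.succ`). The pairing is definite
because the weight is positive on (-a, a) and a nonzero polynomial has finitely many roots. -/

/-! ### Construction of zonal harmonics by recursion -/

section Algebra

variable {N : ℕ}

lemma laplacianPoly_C_mul (c : ℂ) (p : MvPolynomial (Fin N) ℂ) :
    laplacianPoly (MvPolynomial.C c * p) = MvPolynomial.C c * laplacianPoly p := by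
  simp [laplacianPoly, Finset.mul_sum]

lemma laplacianPoly_sub (p q : MvPolynomial (Fin N) ℂ) :
    laplacianPoly (p - q) = laplacianPoly p - laplacianPoly q := by
  simp [laplacianPoly, Finset.sum_sub_distrib]

lemma laplacianPoly_X_mul (i : Fin N) (p : MvPolynomial (Fin N) ℂ) :
    laplacianPoly (MvPolynomial.X i * p) =
      2 * MvPolynomial.pderiv i p + MvPolynomial.X i * laplacianPoly p := by
  have h (j : Fin N) :
      MvPolynomial.pderiv j (MvPolynomial.pderiv j (MvPolynomial.X i * p)) =
        (if j = i then 2 * MvPolynomial.pderiv j p else 0) +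
          MvPolynomial.X i * MvPolynomial.pderiv j (MvPolynomial.pderiv j p) := by
    by_cases hj : j = i
    · subst hj
      simp
      ring
    · simp [MvPolynomial.pderiv_X_of_ne (Ne.symm hj), hj]
  simp only [laplacianPoly, h, Finset.sum_add_distrib, Finset.mul_sum]
  simp

/-- The commutator of two derivations is a derivation, and this one kills every variable. -/
lemma pderiv_pderiv_comm (i j : Fin N) (p : MvPolynomial (Fin N) ℂ) :
    MvPolynomial.pderiv i (MvPolynomial.pderiv j p) =
      MvPolynomial.pderiv j (MvPolynomial.pderiv i p) := by
  have h : ⁅MvPolynomial.pderiv (R := ℂ) i, MvPolynomial.pderiv (R := ℂ) j⁆ = 0 := by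
    refine MvPolynomial.derivation_ext fun k => ?_
    simp [Derivation.commutator_apply, MvPolynomial.pderiv_X, Pi.single_apply, apply_ite]
  have := congrArg (fun D => D p) h
  simpa [Derivation.commutator_apply, sub_eq_zero] using this

lemma laplacianPoly_pderiv (i : Fin N) (p : MvPolynomial (Fin N) ℂ) :
    laplacianPoly (MvPolynomial.pderiv i p) = MvPolynomial.pderiv i (laplacianPoly p) := by
  simp only [laplacianPoly, map_sum]
  refine Finset.sum_congr rfl fun j _ => ?_
  rw [pderiv_pderiv_comm j i p, pderiv_pderiv_comm j i]

/-- The polynomial `X_1^2 + ⋯ + X_N^2`. -/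
noncomputable def normSqPoly (N : ℕ) : MvPolynomial (Fin N) ℂ := ∑ i, MvPolynomial.X i ^ 2

lemma isHomogeneous_normSqPoly : (normSqPoly N).IsHomogeneous 2 :=
  MvPolynomial.IsHomogeneous.sum _ _ _ fun i _ => MvPolynomial.isHomogeneous_X_pow i 2

lemma pderiv_normSqPoly (i : Fin N) :
    MvPolynomial.pderiv i (normSqPoly N) = 2 * MvPolynomial.X i := by
  simp only [normSqPoly, map_sum]
  rw [Finset.sum_eq_single i]
  · simp
  · intro j _ hj
    simp [MvPolynomial.pderiv_X_of_ne hj]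
  · simp

/-- The cross terms are 4 ∑ X_j ∂_j p, which Euler's identity turns into 4m p. -/
lemma laplacianPoly_normSqPoly_mul {p : MvPolynomial (Fin N) ℂ} {m : ℕ}
    (hp : p.IsHomogeneous m) :
    laplacianPoly (normSqPoly N * p) =
      ((2 * N + 4 * m : ℕ) : MvPolynomial (Fin N) ℂ) * p + normSqPoly N * laplacianPoly p := by
  have h (j : Fin N) :
      MvPolynomial.pderiv j (MvPolynomial.pderiv j (normSqPoly N * p)) =
        2 * p + 4 * (MvPolynomial.X j * MvPolynomial.pderiv j p) +
          normSqPoly N * MvPolynomial.pderiv j (MvPolynomial.pderiv j p) := by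
    have h2 : MvPolynomial.pderiv j (2 : MvPolynomial (Fin N) ℂ) = 0 := by
      rw [← map_ofNat (MvPolynomial.C : ℂ →+* MvPolynomial (Fin N) ℂ) 2, MvPolynomial.pderiv_C]
    simp only [MvPolynomial.pderiv_mul, map_add, pderiv_normSqPoly, h2,
      MvPolynomial.pderiv_X_self]
    ring
  simp only [laplacianPoly, h, Finset.sum_add_distrib, ← Finset.mul_sum, hp.sum_X_mul_pderiv]
  simp
  ring

lemma evalReal_normSqPoly (x : EuclideanSpace ℝ (Fin N)) :
    evalReal (normSqPoly N) x = ((‖x‖ ^ 2 : ℝ) : ℂ) := by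
  simp [evalReal, normSqPoly, EuclideanSpace.norm_sq_eq]

lemma evalReal_inFirstVariable [NeZero N] (q : ℂ[X]) (x : EuclideanSpace ℝ (Fin N)) :
    evalReal (inFirstVariable N q) x = q.eval ((x 0 : ℝ) : ℂ) := by
  induction q using Polynomial.induction_on' with
  | add p q hp hq => simp_all [evalReal, inFirstVariable]
  | monomial n c => simp [evalReal, inFirstVariable, ← Polynomial.C_mul_X_pow_eq_monomial]

lemma evalReal_smul_of_isHomogeneous {p : MvPolynomial (Fin N) ℂ} {m : ℕ}
    (hp : p.IsHomogeneous m) (r : ℝ) (x : EuclideanSpace ℝ (Fin N)) :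
    evalReal p (r • x) = (r : ℂ) ^ m * evalReal p x := by
  simp only [evalReal, MvPolynomial.eval_eq, Finset.mul_sum]
  refine Finset.sum_congr rfl fun d hd => ?_
  have hdm : ∑ i ∈ d.support, d i = m := by
    have := hp (MvPolynomial.mem_support_iff.mp hd)
    simpa [Finsupp.weight_apply, Finsupp.sum] using this
  simp only [PiLp.smul_apply, smul_eq_mul, Complex.ofReal_mul, mul_pow, Finset.prod_mul_distrib,
    Finset.prod_pow_eq_pow_sum, hdm]
  ring

/-- Consecutive homogeneous zonal harmonics `A`, `B` of degrees `m`, `m + 1`, together with their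
restrictions `p`, `q` to the sphere of radius `a`. -/
structure ZonalHarmonicPair (N : ℕ) [NeZero N] (a : ℝ) (m : ℕ)
    (A B : MvPolynomial (Fin N) ℂ) (p q : ℂ[X]) (μ : ℝ) : Prop where
  harmonic_left : laplacianPoly A = 0
  harmonic_right : laplacianPoly B = 0
  homogeneous_left : A.IsHomogeneous m
  homogeneous_right : B.IsHomogeneous (m + 1)
  pderiv_right : MvPolynomial.pderiv 0 B = MvPolynomial.C (μ : ℂ) * A
  normSq_mul_pderiv_left : normSqPoly N * MvPolynomial.pderiv 0 A =
    MvPolynomial.C ((N : ℂ) + 2 * m - 2) * (MvPolynomial.X 0 * A - B)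
  monic_left : p.Monic
  natDegree_left : p.natDegree = m
  monic_right : q.Monic
  natDegree_right : q.natDegree = m + 1
  eval_left : ∀ x ∈ Metric.sphere (0 : EuclideanSpace ℝ (Fin N)) a,
    evalReal A x = p.eval ((x 0 : ℝ) : ℂ)
  eval_right : ∀ x ∈ Metric.sphere (0 : EuclideanSpace ℝ (Fin N)) a,
    evalReal B x = q.eval ((x 0 : ℝ) : ℂ)

/-- The next harmonic is D = X_1 B - γ|X|² A. The two derivative relations of the structure are what
the induction must carry: the first makes D harmonic for a suitable γ, and the second makes ∂_1 D a
multiple of B. -/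
lemma ZonalHarmonicPair.succ [NeZero N] {a : ℝ} {m : ℕ}
    {A B : MvPolynomial (Fin N) ℂ} {p q : ℂ[X]} {μ : ℝ} (h : ZonalHarmonicPair N a m A B p q μ) :
    ∃ D r ν, ZonalHarmonicPair N a (m + 1) B D q r ν := by
  obtain ⟨hA, hB, hAm, hBm, hdB, hdA, hp, hpm, hq, hqm, hAp, hBq⟩ := h
  have hNm : (N : ℂ) + 2 * m ≠ 0 := by
    have : N + 2 * m ≠ 0 := by have := NeZero.ne N; omega
    exact_mod_cast this
  -- Since Δ(X_1 B) = 2μ A and Δ(|X|² A) = (2N + 4m) A, harmonicity of D forces γ = μ / (N + 2m).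
  obtain ⟨γ, hγ⟩ : ∃ γ : ℝ, (μ : ℂ) = γ * (N + 2 * m) :=
    ⟨μ / (N + 2 * m), by push_cast; field_simp⟩
  have hlt : (Polynomial.C ((γ * a ^ 2 : ℝ) : ℂ) * p).degree < (Polynomial.X * q).degree := by
    rw [← Polynomial.smul_eq_C_mul]
    refine (Polynomial.degree_smul_le _ _).trans_lt ?_
    rw [Polynomial.degree_mul, Polynomial.degree_X, Polynomial.degree_eq_natDegree hp.ne_zero,
      Polynomial.degree_eq_natDegree hq.ne_zero, hpm, hqm]
    norm_cast
    omega
  -- On the sphere |X|² becomes a², whence the second witness. The third is the factor in ∂_1 D = ν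
  -- B, in which the terms X_1 A cancel.
  refine ⟨MvPolynomial.X 0 * B - MvPolynomial.C (γ : ℂ) * (normSqPoly N * A),
    Polynomial.X * q - Polynomial.C ((γ * a ^ 2 : ℝ) : ℂ) * p,
    1 + γ * (N + 2 * m - 2), hB, ?_, hBm, ?_, ?_, ?_, hq, hqm, ?_, ?_, hBq, ?_⟩
  · rw [laplacianPoly_sub, laplacianPoly_C_mul, laplacianPoly_X_mul,
      laplacianPoly_normSqPoly_mul hAm, hA, hB, hdB, hγ]
    simp [map_ofNat MvPolynomial.C 2]
    ring
  · refine MvPolynomial.IsHomogeneous.sub ?_ ?_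
    · rw [add_comm]
      exact (MvPolynomial.isHomogeneous_X ℂ 0).mul hBm
    · have := (MvPolynomial.isHomogeneous_C (Fin N) (γ : ℂ)).mul
        ((isHomogeneous_normSqPoly (N := N)).mul hAm)
      convert! this using 1
      ring
  · simp only [map_sub, MvPolynomial.pderiv_mul, pderiv_normSqPoly, hdB, hdA,
      MvPolynomial.pderiv_X_self, MvPolynomial.pderiv_C, hγ]
    simp [map_ofNat MvPolynomial.C 2]
    ring
  · rw [hdB, hγ]
    simp
    ring
  · exact (Polynomial.monic_X.mul hq).sub_of_left hlt
  · rw [Polynomial.natDegree_eq_of_degree_eq (Polynomial.degree_sub_eq_left_of_degree_lt hlt),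
      Polynomial.natDegree_X_mul hq.ne_zero, hqm]
  · intro x hx
    have hR := evalReal_normSqPoly x
    have h1 := hAp x hx
    have h2 := hBq x hx
    rw [mem_sphere_zero_iff_norm] at hx
    rw [hx] at hR
    simp only [evalReal] at h1 h2 hR ⊢
    simp [h1, h2, hR]
    ring

/-- For every degree there is a monic zonal harmonic polynomial. -/
theorem exists_isZonalPolynomial (N : ℕ) [NeZero N] (a : ℝ) (m : ℕ) :
    ∃ q, IsZonalPolynomial N a m q := by
  have key : ∃ A B p q μ, ZonalHarmonicPair N a m A B p q μ := by
    induction m with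
    | zero =>
      refine ⟨1, MvPolynomial.X 0, 1, Polynomial.X, 1, ?_⟩
      constructor
      · simp [laplacianPoly]
      · simpa [laplacianPoly] using laplacianPoly_X_mul (0 : Fin N) 1
      · exact MvPolynomial.isHomogeneous_one _ _
      · exact MvPolynomial.isHomogeneous_X _ _
      · simp
      · simp
      · exact Polynomial.monic_one
      · simp
      · exact Polynomial.monic_X
      · simp
      · simp [evalReal]
      · simp [evalReal]
    | succ m ih =>
      obtain ⟨A, B, p, q, μ, h⟩ := ih
      obtain ⟨D, r, ν, h'⟩ := h.succ
      exact ⟨B, D, q, r, ν, h'⟩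
  obtain ⟨A, B, p, q, μ, h⟩ := key
  refine ⟨p, h.monic_left, h.natDegree_left, A, ⟨h.harmonic_left, fun x hx => ?_⟩,
    h.homogeneous_left⟩
  rw [h.eval_left x hx, evalReal_inFirstVariable]

end Algebra

/-! ### A characterization of Gram–Schmidt vectors -/

section GramSchmidt

/-- Both vectors are orthogonal to the span of the earlier `f k`, and their difference lies in that
span, so the difference is orthogonal to itself. -/
lemma InnerProductSpace.eq_gramSchmidt {V : Type*} [NormedAddCommGroup V] [InnerProductSpace ℂ V]
    (f : ℕ → V) (m : ℕ) (v : V) (hv : v - f m ∈ Submodule.span ℂ (f '' Set.Iio m))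
    (ho : ∀ k < m, inner ℂ (f k) v = 0) : v = InnerProductSpace.gramSchmidt ℂ f m := by
  have hg : f m - gramSchmidt ℂ f m ∈ Submodule.span ℂ (f '' Set.Iio m) := by
    rw [← span_gramSchmidt_Iio ℂ f m, gramSchmidt_def'' ℂ f m, add_sub_cancel_left]
    refine Submodule.sum_mem _ fun i hi => Submodule.smul_mem _ _ (Submodule.subset_span ?_)
    exact ⟨i, by simpa using hi, rfl⟩
  have hd := Submodule.add_mem _ hv hg
  rw [sub_add_sub_cancel] at hd
  have hv' : ∀ w ∈ Submodule.span ℂ (f '' Set.Iio m), inner ℂ w v = 0 := by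
    intro w hw
    induction hw using Submodule.span_induction with
    | mem x hx => obtain ⟨k, hk, rfl⟩ := hx; exact ho k hk
    | zero => simp
    | add x y _ _ hx hy => rw [inner_add_left, hx, hy, add_zero]
    | smul c x _ hx => rw [inner_smul_left, hx, mul_zero]
  have hg' : ∀ w ∈ Submodule.span ℂ (f '' Set.Iio m), inner ℂ w (gramSchmidt ℂ f m) = 0 := by
    intro w hw
    rw [← span_gramSchmidt_Iio ℂ f m] at hw
    induction hw using Submodule.span_induction with
    | mem x hx =>
      obtain ⟨k, hk, rfl⟩ := hx
      exact gramSchmidt_orthogonal ℂ f (ne_of_lt hk)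
    | zero => simp
    | add x y _ _ hx hy => rw [inner_add_left, hx, hy, add_zero]
    | smul c x _ hx => rw [inner_smul_left, hx, mul_zero]
  have h0 : inner ℂ (v - gramSchmidt ℂ f m) (v - gramSchmidt ℂ f m) = 0 := by
    rw [inner_sub_right, hv' _ hd, hg' _ hd, sub_zero]
  exact sub_eq_zero.mp (inner_self_eq_zero.mp h0)

lemma eq_gramSchmidtOf {V : Type*} [AddCommGroup V] [Module ℂ V]
    (c : InnerProductSpace.Core ℂ V) (f : ℕ → V) (m : ℕ) (v : V)
    (hv : v - f m ∈ Submodule.span ℂ (f '' Set.Iio m))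
    (ho : ∀ k < m, c.inner (f k) v = 0) : v = gramSchmidtOf c f m := by
  let : NormedAddCommGroup V := c.toNormedAddCommGroup
  let : InnerProductSpace ℂ V := InnerProductSpace.ofCore c.toCore
  exact InnerProductSpace.eq_gramSchmidt f m v hv ho

lemma Polynomial.Monic.sub_X_pow_mem_span {q : ℂ[X]} {m : ℕ} (hq : q.Monic)
    (hm : q.natDegree = m) :
    q - Polynomial.X ^ m ∈
      Submodule.span ℂ ((fun k => (Polynomial.X : ℂ[X]) ^ k) '' Set.Iio m) := by
  have h := Polynomial.as_sum_range_C_mul_X_pow q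
  rw [hm, Finset.sum_range_succ, ← hm, hq.coeff_natDegree, hm, Polynomial.C_1, one_mul] at h
  have h' : q - Polynomial.X ^ m =
      ∑ i ∈ Finset.range m, Polynomial.C (q.coeff i) * Polynomial.X ^ i := by
    conv_lhs => rw [h]
    rw [add_sub_cancel_right]
  rw [h']
  refine Submodule.sum_mem _ fun i hi => ?_
  rw [← Polynomial.smul_eq_C_mul]
  exact Submodule.smul_mem _ _ (Submodule.subset_span ⟨i, by simpa using hi, rfl⟩)

end GramSchmidt

/-! ### Gaussian integrals of polynomials -/

section Gaussian

/-- The moment of order `k` of the weight `exp (-x ^ 2)` on the real line. -/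
noncomputable def gaussMoment (k : ℕ) : ℂ := ∫ x : ℝ, (x : ℂ) ^ k * (Real.exp (-x ^ 2) : ℂ)

lemma integrable_pow_mul_exp_neg_sq (k : ℕ) :
    Integrable fun x : ℝ => (x : ℂ) ^ k * (Real.exp (-x ^ 2) : ℂ) := by
  have h := integrable_rpow_mul_exp_neg_mul_sq (b := 1) one_pos (s := k)
    (by linarith [Nat.cast_nonneg (α := ℝ) k])
  simpa using h.ofReal (𝕜 := ℂ)

lemma integral_Ioi_pow_mul_exp_neg_sq (k : ℕ) :
    ∫ r in Set.Ioi (0 : ℝ), r ^ k * Real.exp (-r ^ 2) = Real.Gamma ((k + 1) / 2) / 2 := by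
  have h := integral_rpow_mul_exp_neg_rpow (p := 2) (q := k) two_pos
    (by linarith [Nat.cast_nonneg (α := ℝ) k])
  simp only [Real.rpow_natCast, Real.rpow_two] at h
  rw [h]
  ring

lemma integral_odd_eq_zero {f : ℝ → ℂ} (hf : ∀ x, f (-x) = -f x) : ∫ x, f x = 0 := by
  have h := integral_neg_eq_self f volume
  simp only [hf, integral_neg] at h
  exact neg_eq_self.mp h

lemma gaussMoment_of_odd {k : ℕ} (hk : Odd k) : gaussMoment k = 0 :=
  integral_odd_eq_zero fun x => by simp [hk.neg_pow]

lemma gaussMoment_of_even {k : ℕ} (hk : Even k) :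
    gaussMoment k = (Real.Gamma ((k + 1) / 2) : ℝ) := by
  have h := integral_comp_abs (f := fun x : ℝ => x ^ k * Real.exp (-x ^ 2))
  simp only [hk.pow_abs, sq_abs, integral_Ioi_pow_mul_exp_neg_sq] at h
  rw [mul_div_cancel₀ _ (two_ne_zero' ℝ)] at h
  rw [← h, ← integral_complex_ofReal]
  simp [gaussMoment]

lemma gaussMoment_one : gaussMoment 1 = 0 := gaussMoment_of_odd odd_one

/-- This is the functional equation of Gamma in even degree; it replaces integration by parts. -/
lemma gaussMoment_add_two (k : ℕ) :
    gaussMoment (k + 2) = (k + 1) / 2 * gaussMoment k := by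
  rcases Nat.even_or_odd k with hk | hk
  · rw [gaussMoment_of_even hk, gaussMoment_of_even (by simpa [Nat.even_add] using hk)]
    have h : ((k + 2 : ℕ) + 1 : ℝ) / 2 = (k + 1) / 2 + 1 := by push_cast; ring
    rw [h, Real.Gamma_add_one (by positivity)]
    push_cast
    ring
  · rw [gaussMoment_of_odd hk, gaussMoment_of_odd (by simpa [Nat.odd_add] using hk), mul_zero]

variable {N : ℕ}

/-- The integral of a polynomial against the Gaussian weight `exp (-‖x‖ ^ 2)`. -/
noncomputable def gaussIntegral (p : MvPolynomial (Fin N) ℂ) : ℂ :=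
  ∫ x : EuclideanSpace ℝ (Fin N), evalReal p x * (Real.exp (-‖x‖ ^ 2) : ℂ)

lemma evalReal_add (p q : MvPolynomial (Fin N) ℂ) (x : EuclideanSpace ℝ (Fin N)) :
    evalReal (p + q) x = evalReal p x + evalReal q x := by
  simp [evalReal]

lemma evalReal_mul (p q : MvPolynomial (Fin N) ℂ) (x : EuclideanSpace ℝ (Fin N)) :
    evalReal (p * q) x = evalReal p x * evalReal q x := by
  simp [evalReal]

lemma continuous_evalReal (p : MvPolynomial (Fin N) ℂ) : Continuous (evalReal p) :=
  (MvPolynomial.continuous_eval p).comp (by fun_prop)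

/-- The Gaussian weight factors over the coordinates, so integrals of monomials become products of
one-variable moments. -/
lemma evalReal_monomial_mul_exp (s : Fin N →₀ ℕ) (c : ℂ) (x : Fin N → ℝ) :
    evalReal (MvPolynomial.monomial s c) (WithLp.toLp 2 x) *
        (Real.exp (-‖(WithLp.toLp 2 x : EuclideanSpace ℝ (Fin N))‖ ^ 2) : ℂ) =
      c * ∏ i, ((x i : ℂ) ^ s i * (Real.exp (-x i ^ 2) : ℂ)) := by
  rw [Finset.prod_mul_distrib, ← Complex.ofReal_prod, ← Real.exp_sum, Finset.sum_neg_distrib,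
    EuclideanSpace.norm_sq_eq]
  simp [evalReal, MvPolynomial.eval_monomial, Finsupp.prod_fintype, mul_assoc]

lemma integrable_evalReal_mul_exp (p : MvPolynomial (Fin N) ℂ) :
    Integrable fun x : EuclideanSpace ℝ (Fin N) => evalReal p x * (Real.exp (-‖x‖ ^ 2) : ℂ) := by
  induction p using MvPolynomial.induction_on' with
  | add p q hp hq =>
    exact (hp.add hq).congr (.of_forall fun x => by simp [evalReal_add, add_mul])
  | monomial s c =>
    rw [← (PiLp.volume_preserving_toLp (Fin N)).integrable_comp_emb
      (MeasurableEquiv.toLp 2 (Fin N → ℝ)).measurableEmbedding]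
    simp only [Function.comp_def, evalReal_monomial_mul_exp]
    exact (Integrable.fintype_prod
      (f := fun i (y : ℝ) => (y : ℂ) ^ s i * (Real.exp (-y ^ 2) : ℂ))
      fun i => integrable_pow_mul_exp_neg_sq (s i)).const_mul c

lemma gaussIntegral_add (p q : MvPolynomial (Fin N) ℂ) :
    gaussIntegral (p + q) = gaussIntegral p + gaussIntegral q := by
  simp only [gaussIntegral, evalReal_add, add_mul]
  exact integral_add (integrable_evalReal_mul_exp p) (integrable_evalReal_mul_exp q)

lemma gaussIntegral_C_mul (c : ℂ) (p : MvPolynomial (Fin N) ℂ) :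
    gaussIntegral (MvPolynomial.C c * p) = c * gaussIntegral p := by
  simp only [gaussIntegral, evalReal_mul, mul_assoc, ← integral_const_mul]
  simp [evalReal]

lemma gaussIntegral_zero : gaussIntegral (0 : MvPolynomial (Fin N) ℂ) = 0 := by
  simpa using gaussIntegral_C_mul 0 (0 : MvPolynomial (Fin N) ℂ)

lemma gaussIntegral_sum {ι : Type*} (s : Finset ι) (f : ι → MvPolynomial (Fin N) ℂ) :
    gaussIntegral (∑ i ∈ s, f i) = ∑ i ∈ s, gaussIntegral (f i) := by
  classical
  induction s using Finset.induction_on with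
  | empty => simp [gaussIntegral_zero]
  | insert i s hi ih => rw [Finset.sum_insert hi, Finset.sum_insert hi, gaussIntegral_add, ih]

lemma gaussIntegral_monomial (s : Fin N →₀ ℕ) (c : ℂ) :
    gaussIntegral (MvPolynomial.monomial s c) = c * ∏ i, gaussMoment (s i) := by
  rw [gaussIntegral, ← (PiLp.volume_preserving_toLp (Fin N)).integral_comp
    (MeasurableEquiv.toLp 2 (Fin N → ℝ)).measurableEmbedding]
  simp only [evalReal_monomial_mul_exp, integral_const_mul]
  rw [integral_fintype_prod_volume_eq_prod
    (fun i (y : ℝ) => (y : ℂ) ^ s i * (Real.exp (-y ^ 2) : ℂ))]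
  rfl

lemma gaussIntegral_X_mul (i : Fin N) (p : MvPolynomial (Fin N) ℂ) :
    gaussIntegral (MvPolynomial.X i * p) = gaussIntegral (MvPolynomial.pderiv i p) / 2 := by
  induction p using MvPolynomial.induction_on' with
  | add p q hp hq => rw [mul_add, map_add, gaussIntegral_add, gaussIntegral_add, hp, hq, add_div]
  | monomial s c =>
    rw [MvPolynomial.X, MvPolynomial.monomial_mul, MvPolynomial.pderiv_monomial,
      gaussIntegral_monomial, gaussIntegral_monomial,
      ← Finset.mul_prod_erase _ _ (Finset.mem_univ i),
      ← Finset.mul_prod_erase _ _ (Finset.mem_univ i)]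
    have h : ∀ j ∈ Finset.univ.erase i, gaussMoment ((Finsupp.single i 1 + s : Fin N →₀ ℕ) j) =
        gaussMoment ((s - Finsupp.single i 1 : Fin N →₀ ℕ) j) := by
      intro j hj
      simp [Finsupp.single_eq_of_ne (Finset.ne_of_mem_erase hj)]
    rw [Finset.prod_congr rfl h]
    simp only [Finsupp.add_apply, Finsupp.tsub_apply, Finsupp.single_eq_same]
    -- If the exponent of X_i is 0, the truncated exponent 0 - 1 is harmless: the derivative has
    -- coefficient 0, and the first moment on the other side vanishes.
    rcases hs : s i with _ | k
    · simp [gaussMoment_one]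
    · rw [show 1 + (k + 1) = k + 2 by ring, gaussMoment_add_two, Nat.add_sub_cancel]
      push_cast
      ring

/-- A homogeneous harmonic polynomial of positive degree is orthogonal to lower powers of a
coordinate, for the Gaussian weight. -/
lemma gaussIntegral_harmonic_mul_X_pow (i : Fin N) (k : ℕ) :
    ∀ (m : ℕ) (h : MvPolynomial (Fin N) ℂ), k < m → h.IsHomogeneous m → laplacianPoly h = 0 →
      gaussIntegral (h * MvPolynomial.X i ^ k) = 0 := by
  induction k with
  | zero =>
    intro m h hm hh hL
    have e : gaussIntegral (∑ j, MvPolynomial.X j * MvPolynomial.pderiv j h) =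
        gaussIntegral (laplacianPoly h) / 2 := by
      simp only [laplacianPoly, gaussIntegral_sum, gaussIntegral_X_mul, Finset.sum_div]
    rw [hh.sum_X_mul_pderiv, hL, gaussIntegral_zero, zero_div, nsmul_eq_mul,
      ← map_natCast (MvPolynomial.C : ℂ →+* MvPolynomial (Fin N) ℂ), gaussIntegral_C_mul] at e
    rw [pow_zero, mul_one]
    exact (mul_eq_zero.mp e).resolve_left (by exact_mod_cast hm.ne')
  | succ k ih =>
    intro m h hm hh hL
    -- By Euler's identity the left side is m times the desired integral. Trading each X_j for ∂_j /
    -- 2 leaves a Δh term and a term in ∂_i h, which is harmonic of degree m - 1 and falls to the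
    -- induction hypothesis.
    have e : gaussIntegral ((∑ j, MvPolynomial.X j * MvPolynomial.pderiv j h) *
        MvPolynomial.X i ^ (k + 1)) =
        gaussIntegral (laplacianPoly h * MvPolynomial.X i ^ (k + 1) +
          MvPolynomial.C ((k : ℂ) + 1) *
            (MvPolynomial.pderiv i h * MvPolynomial.X i ^ k)) / 2 := by
      have hsum : laplacianPoly h * MvPolynomial.X i ^ (k + 1) +
          MvPolynomial.C ((k : ℂ) + 1) * (MvPolynomial.pderiv i h * MvPolynomial.X i ^ k) =
          ∑ j, MvPolynomial.pderiv j (MvPolynomial.pderiv j h * MvPolynomial.X i ^ (k + 1)) := by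
        simp only [MvPolynomial.pderiv_mul, Finset.sum_add_distrib, laplacianPoly, Finset.sum_mul]
        congr 1
        rw [Finset.sum_eq_single i]
        · simp
          ring
        · intro j _ hj
          simp [MvPolynomial.pderiv_X_of_ne hj.symm]
        · simp
      rw [hsum]
      simp only [Finset.sum_mul, gaussIntegral_sum, mul_assoc, gaussIntegral_X_mul,
        Finset.sum_div]
    have h0 : gaussIntegral (MvPolynomial.pderiv i h * MvPolynomial.X i ^ k) = 0 :=
      ih (m - 1) _ (by omega) hh.pderiv (by rw [laplacianPoly_pderiv, hL, map_zero])
    rw [hh.sum_X_mul_pderiv, hL, zero_mul, zero_add, gaussIntegral_C_mul, h0, mul_zero, zero_div,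
      nsmul_eq_mul, ← map_natCast (MvPolynomial.C : ℂ →+* MvPolynomial (Fin N) ℂ), mul_assoc,
      gaussIntegral_C_mul] at e
    exact (mul_eq_zero.mp e).resolve_left (by exact_mod_cast (by omega : m ≠ 0))

/-- Integration in polar coordinates of a homogeneous polynomial against the Gaussian weight. -/
lemma gaussIntegral_eq_integral_sphere [NeZero N] {p : MvPolynomial (Fin N) ℂ} {d : ℕ}
    (hp : p.IsHomogeneous d) :
    gaussIntegral p =
      (∫ x : Metric.sphere (0 : EuclideanSpace ℝ (Fin N)) 1,
        evalReal p x ∂(volume : Measure (EuclideanSpace ℝ (Fin N))).toSphere) *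
      ((Real.Gamma ((d + N) / 2) / 2 : ℝ) : ℂ) := by
  have hN := NeZero.pos N
  -- The radial factor: r^d from homogeneity and r^(N-1) from the volume element give a moment of
  -- order d + N - 1.
  have hr : ∫ r : Set.Ioi (0 : ℝ), ((r.1 ^ d * Real.exp (-r.1 ^ 2) : ℝ) : ℂ)
      ∂(Measure.volumeIoiPow (Module.finrank ℝ (EuclideanSpace ℝ (Fin N)) - 1)) =
      ((Real.Gamma ((d + N) / 2) / 2 : ℝ) : ℂ) := by
    rw [integral_complex_ofReal]
    congr 1
    simp only [Measure.volumeIoiPow, ENNReal.ofReal, finrank_euclideanSpace, Fintype.card_fin]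
    rw [integral_withDensity_eq_integral_smul
      ((measurable_subtype_coe.pow_const _).real_toNNReal),
      integral_subtype_comap measurableSet_Ioi
        fun r : ℝ => Real.toNNReal (r ^ (N - 1)) • (r ^ d * Real.exp (-r ^ 2))]
    have h := integral_Ioi_pow_mul_exp_neg_sq (d + N - 1)
    rw [Nat.cast_sub (by omega)] at h
    push_cast at h
    rw [sub_add_cancel] at h
    rw [← h]
    refine setIntegral_congr_fun measurableSet_Ioi fun r (hr : 0 < r) => ?_
    rw [NNReal.smul_def, Real.coe_toNNReal _ (pow_nonneg hr.le _), smul_eq_mul, ← mul_assoc,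
      ← pow_add]
    congr 2
    omega
  -- Polar coordinates live off the origin, a null set since N > 0.
  have hl : gaussIntegral p = ∫ x : ({0}ᶜ : Set (EuclideanSpace ℝ (Fin N))),
      evalReal p x.1 * (Real.exp (-‖x.1‖ ^ 2) : ℂ) ∂(volume.comap Subtype.val) := by
    rw [integral_subtype_comap (measurableSet_singleton _).compl
      fun x : EuclideanSpace ℝ (Fin N) => evalReal p x * (Real.exp (-‖x‖ ^ 2) : ℂ),
      restrict_compl_singleton, gaussIntegral]
  rw [hl, ← hr, ← integral_prod_mul, ← (Measure.measurePreserving_homeomorphUnitSphereProd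
    (volume : Measure (EuclideanSpace ℝ (Fin N)))).integral_comp
      (Homeomorph.measurableEmbedding _)]
  refine integral_congr_ae (.of_forall fun x => ?_)
  have hx : ‖x.1‖ ≠ 0 := norm_ne_zero_iff.mpr x.2
  have e := evalReal_smul_of_isHomogeneous hp ‖x.1‖ (‖x.1‖⁻¹ • x.1)
  rw [smul_inv_smul₀ hx] at e
  simp [e]
  ring

end Gaussian

/-! ### Moments of the weight as Beta values -/

section Weight

lemma Complex.ofReal_beta_integrand (u v : ℝ) {x : ℝ} (hx : x ∈ Set.Ioo (0 : ℝ) 1) :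
    (x : ℂ) ^ ((u : ℂ) - 1) * (1 - (x : ℂ)) ^ ((v : ℂ) - 1) =
      ((x ^ (u - 1) * (1 - x) ^ (v - 1) : ℝ) : ℂ) := by
  rw [Complex.ofReal_mul, Complex.ofReal_cpow hx.1.le, Complex.ofReal_cpow (sub_nonneg.2 hx.2.le)]
  push_cast
  rfl

lemma integrableOn_beta {u v : ℝ} (hu : 0 < u) (hv : 0 < v) :
    IntegrableOn (fun x : ℝ => x ^ (u - 1) * (1 - x) ^ (v - 1)) (Set.Ioo 0 1) := by
  have h := Complex.betaIntegral_convergent (u := u) (v := v) (by simpa) (by simpa)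
  rw [intervalIntegrable_iff_integrableOn_Ioo_of_le zero_le_one] at h
  refine IntegrableOn.congr_fun (Integrable.re h) (fun x hx => ?_) measurableSet_Ioo
  simp only [Complex.ofReal_beta_integrand u v hx, RCLike.re_to_complex, Complex.ofReal_re]

lemma setIntegral_beta {u v : ℝ} (hu : 0 < u) (hv : 0 < v) :
    ∫ x in Set.Ioo (0 : ℝ) 1, x ^ (u - 1) * (1 - x) ^ (v - 1) = ProbabilityTheory.beta u v := by
  rw [ProbabilityTheory.beta_eq_betaIntegralReal u v hu hv, Complex.betaIntegral,
    intervalIntegral.integral_of_le zero_le_one, integral_Ioc_eq_integral_Ioo,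
    setIntegral_congr_fun measurableSet_Ioo fun x hx => Complex.ofReal_beta_integrand u v hx,
    integral_complex_ofReal, Complex.ofReal_re]

lemma image_sq_Ioo_zero_one : (fun t : ℝ => t ^ 2) '' Set.Ioo 0 1 = Set.Ioo 0 1 := by
  ext u
  constructor
  · rintro ⟨t, ht, rfl⟩
    exact ⟨pow_pos ht.1 2, pow_lt_one₀ ht.1.le ht.2 two_ne_zero⟩
  · intro hu
    exact ⟨√u, ⟨Real.sqrt_pos.2 hu.1, (Real.sqrt_lt' one_pos).2 (by simpa using hu.2)⟩,
      Real.sq_sqrt hu.1.le⟩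

lemma injOn_sq_Ioo_zero_one : Set.InjOn (fun t : ℝ => t ^ 2) (Set.Ioo 0 1) :=
  fun _ hs _ ht h => (pow_left_inj₀ hs.1.le ht.1.le two_ne_zero).1 h

/-- The substitution u = t² in the Beta integral: its Jacobian 2t turns t^(k-1) into 2t^k. -/
lemma abs_two_mul_smul_beta_integrand (k : ℕ) (v : ℝ) {t : ℝ} (ht : t ∈ Set.Ioo (0 : ℝ) 1) :
    |2 * t| • ((t ^ 2) ^ (((k : ℝ) + 1) / 2 - 1) * (1 - t ^ 2) ^ (v - 1)) =
      2 * (t ^ k * (1 - t ^ 2) ^ (v - 1)) := by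
  have h : (t ^ 2) ^ (((k : ℝ) + 1) / 2 - 1) = t ^ k / t := by
    rw [← Real.rpow_natCast t 2, ← Real.rpow_mul ht.1.le, ← Real.rpow_natCast t k,
      ← Real.rpow_sub_one ht.1.ne']
    congr 1
    push_cast
    ring
  rw [h, abs_of_pos (mul_pos two_pos ht.1), smul_eq_mul]
  have := ht.1.ne'
  field_simp

lemma hasDerivWithinAt_sq (s : Set ℝ) (t : ℝ) :
    HasDerivWithinAt (fun t : ℝ => t ^ 2) (2 * t) s t := by
  simpa using (hasDerivAt_pow 2 t).hasDerivWithinAt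

lemma integrableOn_pow_mul_one_sub_sq_rpow (k : ℕ) {v : ℝ} (hv : 0 < v) :
    IntegrableOn (fun t : ℝ => t ^ k * (1 - t ^ 2) ^ (v - 1)) (Set.Ioo 0 1) := by
  have h := integrableOn_beta (u := ((k : ℝ) + 1) / 2) (by positivity) hv
  rw [← image_sq_Ioo_zero_one, integrableOn_image_iff_integrableOn_abs_deriv_smul
    measurableSet_Ioo (fun t _ => hasDerivWithinAt_sq _ t) injOn_sq_Ioo_zero_one] at h
  have h' := h.congr_fun (fun t ht => abs_two_mul_smul_beta_integrand k v ht) measurableSet_Ioo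
  refine IntegrableOn.congr_fun (h'.const_mul 2⁻¹) (fun t _ => ?_) measurableSet_Ioo
  simp

lemma setIntegral_pow_mul_one_sub_sq_rpow (k : ℕ) {v : ℝ} (hv : 0 < v) :
    ∫ t in Set.Ioo (0 : ℝ) 1, t ^ k * (1 - t ^ 2) ^ (v - 1) =
      ProbabilityTheory.beta (((k : ℝ) + 1) / 2) v / 2 := by
  rw [← setIntegral_beta (u := ((k : ℝ) + 1) / 2) (by positivity) hv]
  conv_rhs =>
    rw [← image_sq_Ioo_zero_one, integral_image_eq_integral_abs_deriv_smul
      measurableSet_Ioo (fun t _ => hasDerivWithinAt_sq _ t) injOn_sq_Ioo_zero_one,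
      setIntegral_congr_fun measurableSet_Ioo
        fun t ht => abs_two_mul_smul_beta_integrand k v ht]
  rw [integral_const_mul, mul_div_cancel_left₀ _ two_ne_zero]

lemma intervalIntegrable_one_sub_sq_rpow {v : ℝ} (hv : 0 < v) :
    IntervalIntegrable (fun t : ℝ => (1 - t ^ 2) ^ (v - 1)) volume (-1) 1 := by
  have h : IntervalIntegrable (fun t : ℝ => (1 - t ^ 2) ^ (v - 1)) volume 0 1 := by
    rw [intervalIntegrable_iff_integrableOn_Ioo_of_le zero_le_one]
    simpa using integrableOn_pow_mul_one_sub_sq_rpow 0 hv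
  have h' := h
  rw [IntervalIntegrable.iff_comp_neg] at h'
  simp only [neg_sq, neg_zero] at h'
  exact h'.symm.trans h

lemma integral_pow_mul_one_sub_sq_rpow_of_odd {k : ℕ} (hk : Odd k) (e : ℝ) :
    ∫ t in (-1 : ℝ)..1, t ^ k * (1 - t ^ 2) ^ e = 0 := by
  have h := intervalIntegral.integral_comp_neg (a := -1) (b := 1)
    (fun t : ℝ => t ^ k * (1 - t ^ 2) ^ e)
  simp only [hk.neg_pow, neg_sq, neg_mul, intervalIntegral.integral_neg, neg_neg] at h
  linarith

lemma integral_pow_mul_one_sub_sq_rpow_of_even {k : ℕ} (hk : Even k) {v : ℝ} (hv : 0 < v) :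
    ∫ t in (-1 : ℝ)..1, t ^ k * (1 - t ^ 2) ^ (v - 1) =
      ProbabilityTheory.beta (((k : ℝ) + 1) / 2) v := by
  have h01 : ∫ t in (0 : ℝ)..1, t ^ k * (1 - t ^ 2) ^ (v - 1) =
      ProbabilityTheory.beta (((k : ℝ) + 1) / 2) v / 2 := by
    rw [intervalIntegral.integral_of_le zero_le_one, integral_Ioc_eq_integral_Ioo,
      setIntegral_pow_mul_one_sub_sq_rpow k hv]
  have hneg := intervalIntegral.integral_comp_neg (a := 0) (b := 1)
    (fun t : ℝ => t ^ k * (1 - t ^ 2) ^ (v - 1))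
  simp only [hk.neg_pow, neg_sq, neg_zero] at hneg
  have hi : IntervalIntegrable (fun t : ℝ => t ^ k * (1 - t ^ 2) ^ (v - 1)) volume (-1) 1 :=
    (intervalIntegrable_one_sub_sq_rpow hv).continuousOn_mul (by fun_prop)
  rw [← intervalIntegral.integral_add_adjacent_intervals (b := 0)
    (hi.mono_set (Set.uIcc_subset_uIcc (by simp) (by simp)))
    (hi.mono_set (Set.uIcc_subset_uIcc (by simp) (by simp))), ← hneg, h01]
  ring

lemma intervalIntegrable_weight (a : ℝ) {v : ℝ} (hv : 0 < v) :
    IntervalIntegrable (fun x : ℝ => (1 - x ^ 2 / a ^ 2) ^ (v - 1)) volume (-a) a := by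
  have h := (intervalIntegrable_one_sub_sq_rpow hv).comp_mul_left (c := a⁻¹)
  simpa [mul_pow, div_eq_inv_mul] using h

lemma integral_pow_mul_weight {a : ℝ} (ha : 0 < a) (k : ℕ) (e : ℝ) :
    ∫ x in (-a)..a, x ^ k * (1 - x ^ 2 / a ^ 2) ^ e =
      a ^ (k + 1) * ∫ t in (-1 : ℝ)..1, t ^ k * (1 - t ^ 2) ^ e := by
  have h := intervalIntegral.integral_comp_div (a := -a) (b := a)
    (fun t : ℝ => a ^ k * (t ^ k * (1 - t ^ 2) ^ e)) ha.ne'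
  rw [neg_div, div_self ha.ne', smul_eq_mul] at h
  rw [pow_succ' a k, mul_assoc, ← intervalIntegral.integral_const_mul, ← h]
  refine intervalIntegral.integral_congr fun x _ => ?_
  simp only [div_pow]
  field_simp

lemma intervalIntegrable_eval_mul_weight (a : ℝ) {v : ℝ} (hv : 0 < v) (p : ℂ[X]) :
    IntervalIntegrable
      (fun x : ℝ => p.eval (x : ℂ) * (((1 - x ^ 2 / a ^ 2) ^ (v - 1) : ℝ) : ℂ))
      volume (-a) a := by
  have h : IntervalIntegrable
      (fun x : ℝ => (((1 - x ^ 2 / a ^ 2) ^ (v - 1) : ℝ) : ℂ)) volume (-a) a :=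
    ⟨(intervalIntegrable_weight a hv).1.ofReal, (intervalIntegrable_weight a hv).2.ofReal⟩
  exact h.continuousOn_mul (p.continuous.comp Complex.continuous_ofReal).continuousOn

end Weight

/-! ### Distribution of a coordinate on the sphere -/

section Sphere

/-- Polar coordinates applied to the constant polynomial 1. -/
lemma sphereArea_mul_Gamma (j : ℕ) :
    sphereArea j * (Real.Gamma (((j : ℝ) + 1) / 2) / 2) = Real.Gamma (1 / 2) ^ (j + 1) := by
  have h := gaussIntegral_eq_integral_sphere (N := j + 1) (MvPolynomial.isHomogeneous_one _ ℂ)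
  have h1 : gaussIntegral (1 : MvPolynomial (Fin (j + 1)) ℂ) =
      ((Real.Gamma (1 / 2) ^ (j + 1) : ℝ) : ℂ) := by
    have := gaussIntegral_monomial (0 : Fin (j + 1) →₀ ℕ) 1
    simpa [gaussMoment_of_even] using this
  rw [h1] at h
  have h2 : ∀ x : EuclideanSpace ℝ (Fin (j + 1)), evalReal 1 x = 1 := by simp [evalReal]
  simp only [h2, integral_const, Complex.real_smul, mul_one, ← Complex.ofReal_mul,
    Complex.ofReal_inj] at h
  rw [sphereArea, h]
  simp

lemma sphereArea_pos (j : ℕ) : 0 < sphereArea j := by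
  have h := sphereArea_mul_Gamma j
  have h1 : 0 < Real.Gamma (((j : ℝ) + 1) / 2) := Real.Gamma_pos_of_pos (by positivity)
  have h2 : 0 < Real.Gamma (1 / 2) := Real.Gamma_pos_of_pos (by norm_num)
  have h3 : 0 < sphereArea j * (Real.Gamma (((j : ℝ) + 1) / 2) / 2) := by rw [h]; positivity
  exact pos_of_mul_pos_left h3 (by positivity)

lemma integral_uniformSphere (n : ℕ) (a : ℝ) {f : EuclideanSpace ℝ (Fin (n + 1)) → ℂ}
    (hf : Continuous f) :
    ∫ x, f x ∂(uniformSphere (n + 1) a) =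
      ((sphereArea n : ℝ) : ℂ)⁻¹ * ∫ x : Metric.sphere (0 : EuclideanSpace ℝ (Fin (n + 1))) 1,
        f (a • x) ∂(volume : Measure (EuclideanSpace ℝ (Fin (n + 1)))).toSphere := by
  rw [uniformSphere, integral_smul_measure, integral_map (by fun_prop)
    hf.aestronglyMeasurable, ENNReal.toReal_inv, Complex.real_smul, Complex.ofReal_inv]
  rfl

/-- The moments of a coordinate on the unit sphere. -/
lemma integral_sphere_coordinate_pow (n k : ℕ) :
    ∫ x : Metric.sphere (0 : EuclideanSpace ℝ (Fin (n + 2))) 1, ((x.1 0 : ℝ) : ℂ) ^ k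
        ∂(volume : Measure (EuclideanSpace ℝ (Fin (n + 2)))).toSphere =
      ((sphereArea n * ∫ t in (-1 : ℝ)..1, t ^ k * (1 - t ^ 2) ^ (((n : ℝ) + 1) / 2 - 1) : ℝ) : ℂ)
      := by
  have h := gaussIntegral_eq_integral_sphere
    (MvPolynomial.isHomogeneous_X_pow (R := ℂ) (0 : Fin (n + 2)) k)
  have h1 : gaussIntegral ((MvPolynomial.X 0 : MvPolynomial (Fin (n + 2)) ℂ) ^ k) =
      gaussMoment k * ((Real.Gamma (1 / 2) ^ (n + 1) : ℝ) : ℂ) := by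
    rw [MvPolynomial.X_pow_eq_monomial, gaussIntegral_monomial, Fin.prod_univ_succ]
    simp [gaussMoment_of_even]
  have hG : Real.Gamma (((k : ℝ) + (n + 2 : ℕ)) / 2) ≠ 0 :=
    (Real.Gamma_pos_of_pos (by positivity)).ne'
  simp only [h1, evalReal, map_pow, MvPolynomial.eval_X] at h
  rw [eq_comm, ← eq_div_iff (by exact_mod_cast div_ne_zero hG two_ne_zero)] at h
  rw [h]
  rcases Nat.even_or_odd k with hk | hk
  -- Rewriting Γ(1/2)^(n+1) through `sphereArea n` supplies the factor Γ((n+1)/2) that completes the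
  -- Beta quotient.
  · rw [integral_pow_mul_one_sub_sq_rpow_of_even hk (by positivity), gaussMoment_of_even hk,
      ← sphereArea_mul_Gamma, ProbabilityTheory.beta]
    rw [← Complex.ofReal_mul, ← Complex.ofReal_div, Complex.ofReal_inj]
    rw [show ((k : ℝ) + (n + 2 : ℕ)) / 2 = ((k : ℝ) + 1) / 2 + ((n : ℝ) + 1) / 2 by
      push_cast; ring] at hG ⊢
    field_simp
  · rw [integral_pow_mul_one_sub_sq_rpow_of_odd hk, gaussMoment_of_odd hk]
    simp

/-- Linearity reduces this to monomials, where rescaling gives a^k on the sphere and a^(k+1) on the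
interval; the prefactor 1/a absorbs the difference. -/
lemma integral_uniformSphere_eval (n : ℕ) {a : ℝ} (ha : 0 < a) (p : ℂ[X]) :
    ∫ x, p.eval ((x 0 : ℝ) : ℂ) ∂(uniformSphere (n + 2) a) =
      ((sphereArea n / (sphereArea (n + 1) * a) : ℝ) : ℂ) * ∫ x in (-a)..a,
        p.eval (x : ℂ) * (((1 - x ^ 2 / a ^ 2) ^ (((n : ℝ) + 1) / 2 - 1) : ℝ) : ℂ) := by
  have hc (q : ℂ[X]) : Continuous fun x : EuclideanSpace ℝ (Fin (n + 2)) =>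
      q.eval ((x 0 : ℝ) : ℂ) := q.continuous.comp (by fun_prop)
  rw [integral_uniformSphere (n + 1) a (hc p)]
  induction p using Polynomial.induction_on' with
  | add p q hp hq =>
    have hi (q : ℂ[X]) : Integrable
        (fun x : Metric.sphere (0 : EuclideanSpace ℝ (Fin (n + 2))) 1 =>
          q.eval (((a • x.1) 0 : ℝ) : ℂ))
        (volume : Measure (EuclideanSpace ℝ (Fin (n + 2)))).toSphere :=
      Continuous.integrable_of_hasCompactSupport
        ((hc q).comp (by fun_prop : Continuous fun x : Metric.sphere _ _ => a • x.1))
        (HasCompactSupport.of_compactSpace _)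
    simp only [Polynomial.eval_add, add_mul]
    rw [intervalIntegral.integral_add
      (intervalIntegrable_eval_mul_weight a (by positivity) p)
      (intervalIntegrable_eval_mul_weight a (by positivity) q),
      integral_add (hi p) (hi q), mul_add, mul_add, hp, hq]
  | monomial k c =>
    have h := integral_sphere_coordinate_pow n k
    have h2 := integral_pow_mul_weight ha k (((n : ℝ) + 1) / 2 - 1)
    have h3 : ∫ x in (-a)..a,
        (x : ℂ) ^ k * (((1 - x ^ 2 / a ^ 2) ^ (((n : ℝ) + 1) / 2 - 1) : ℝ) : ℂ) =
        ((∫ x in (-a)..a, x ^ k * (1 - x ^ 2 / a ^ 2) ^ (((n : ℝ) + 1) / 2 - 1) : ℝ) : ℂ) := by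
      rw [← intervalIntegral.integral_ofReal]
      simp
    simp only [Polynomial.eval_monomial, PiLp.smul_apply, smul_eq_mul, Complex.ofReal_mul, mul_pow,
      mul_assoc, integral_const_mul, intervalIntegral.integral_const_mul]
    rw [h, h3, h2]
    have h4 := (sphereArea_pos (n + 1)).ne'
    push_cast
    have h5 : ((sphereArea (n + 1) : ℝ) : ℂ) ≠ 0 := by exact_mod_cast h4
    have h6 : (a : ℂ) ≠ 0 := by exact_mod_cast ha.ne'
    field_simp
    ring

end Sphere

/-! ### The inner product and orthogonality -/

section Pairing

/-- At real points p q̄ is thus the value of a single polynomial, so facts about integrals of one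
polynomial apply to the pairing. -/
lemma Polynomial.eval_ofReal_map_conj (q : ℂ[X]) (x : ℝ) :
    (q.map (starRingEnd ℂ)).eval (x : ℂ) = conj (q.eval (x : ℂ)) := by
  have h := Polynomial.eval_map_apply (p := q) (starRingEnd ℂ) (x : ℂ)
  rwa [Complex.conj_ofReal] at h

lemma weightPairing_eq (n : ℕ) (a : ℝ) (p q : ℂ[X]) :
    weightPairing (n + 2) a p q =
      ((sphereArea n / (sphereArea (n + 1) * a) : ℝ) : ℂ) * ∫ x in (-a)..a,
        (p * q.map (starRingEnd ℂ)).eval (x : ℂ) *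
          (((1 - x ^ 2 / a ^ 2) ^ (((n : ℝ) + 1) / 2 - 1) : ℝ) : ℂ) := by
  have he : ((n + 2 : ℕ) - 3 : ℝ) / 2 = ((n : ℝ) + 1) / 2 - 1 := by push_cast; ring
  simp only [weightPairing, he, Polynomial.eval_mul, Polynomial.eval_ofReal_map_conj]
  rfl

theorem spherePairing_eq_weightPairing (n : ℕ) {a : ℝ} (ha : 0 < a) (p q : ℂ[X]) :
    spherePairing a (inFirstVariable (n + 2) p) (inFirstVariable (n + 2) q) =
      weightPairing (n + 2) a p q := by
  rw [weightPairing_eq, ← integral_uniformSphere_eval n ha]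
  simp only [spherePairing, evalReal_inFirstVariable, Polynomial.eval_mul,
    Polynomial.eval_ofReal_map_conj]

lemma weightPairing_add_right (n : ℕ) (a : ℝ) (p q r : ℂ[X]) :
    weightPairing (n + 2) a p (q + r) =
      weightPairing (n + 2) a p q + weightPairing (n + 2) a p r := by
  simp only [weightPairing_eq, Polynomial.map_add, mul_add, Polynomial.eval_add, add_mul]
  rw [intervalIntegral.integral_add
    (intervalIntegrable_eval_mul_weight a (by positivity) _)
    (intervalIntegrable_eval_mul_weight a (by positivity) _), mul_add]

lemma weightPairing_smul_right (N : ℕ) (a : ℝ) (p q : ℂ[X]) (c : ℂ) :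
    weightPairing N a p (c • q) = conj c * weightPairing N a p q := by
  simp only [weightPairing, Polynomial.eval_smul, smul_eq_mul, map_mul]
  rw [mul_left_comm, ← intervalIntegral.integral_const_mul (conj c)]
  congr 1
  refine intervalIntegral.integral_congr fun x _ => ?_
  ring

lemma conj_weightPairing (N : ℕ) (a : ℝ) (p q : ℂ[X]) :
    conj (weightPairing N a p q) = weightPairing N a q p := by
  simp only [weightPairing, map_mul, Complex.conj_ofReal, intervalIntegral, map_sub,
    ← integral_conj, Complex.conj_conj]
  simp only [mul_comm (conj _)]

lemma weightPairing_self (N : ℕ) (a : ℝ) (p : ℂ[X]) :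
    weightPairing N a p p = ((sphereArea (N - 2) / (sphereArea (N - 1) * a) *
      ∫ x in (-a)..a, Complex.normSq (p.eval (x : ℂ)) *
        (1 - x ^ 2 / a ^ 2) ^ (((N : ℝ) - 3) / 2) : ℝ) : ℂ) := by
  rw [Complex.ofReal_mul, ← intervalIntegral.integral_ofReal]
  simp [weightPairing, Complex.mul_conj]

lemma sphereArea_ratio_pos (i j : ℕ) {a : ℝ} (ha : 0 < a) :
    0 < sphereArea i / (sphereArea j * a) :=
  div_pos (sphereArea_pos i) (mul_pos (sphereArea_pos j) ha)

lemma one_sub_sq_div_sq_nonneg {a x : ℝ} (hx : x ∈ Set.Icc (-a) a) :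
    0 ≤ 1 - x ^ 2 / a ^ 2 :=
  sub_nonneg.2 (div_le_one_of_le₀ (sq_le_sq' hx.1 hx.2) (sq_nonneg a))

lemma one_sub_sq_div_sq_pos {a x : ℝ} (hx : x ∈ Set.Ioo (-a) a) :
    0 < 1 - x ^ 2 / a ^ 2 := by
  have ha : 0 < a := by linarith [hx.1, hx.2]
  exact sub_pos.2 ((div_lt_one (pow_pos ha 2)).2 (sq_lt_sq' hx.1 hx.2))

lemma normSq_mul_weight_nonneg (p : ℂ[X]) (e : ℝ) {a x : ℝ} (hx : x ∈ Set.Icc (-a) a) :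
    0 ≤ Complex.normSq (p.eval (x : ℂ)) * (1 - x ^ 2 / a ^ 2) ^ e :=
  mul_nonneg (Complex.normSq_nonneg _) (Real.rpow_nonneg (one_sub_sq_div_sq_nonneg hx) _)

lemma integral_normSq_mul_weight_nonneg (p : ℂ[X]) (e : ℝ) {a : ℝ} (ha : 0 < a) :
    0 ≤ ∫ x in (-a)..a, Complex.normSq (p.eval (x : ℂ)) * (1 - x ^ 2 / a ^ 2) ^ e :=
  intervalIntegral.integral_nonneg (by linarith) fun _ hx => normSq_mul_weight_nonneg p e hx

lemma eq_zero_of_integral_normSq_mul_weight_eq_zero {p : ℂ[X]} {a v : ℝ} (ha : 0 < a) (hv : 0 < v)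
    (h : ∫ x in (-a)..a, Complex.normSq (p.eval (x : ℂ)) * (1 - x ^ 2 / a ^ 2) ^ (v - 1) = 0) :
    p = 0 := by
  have hle : -a ≤ a := by linarith
  have hi : IntervalIntegrable
      (fun x : ℝ => Complex.normSq (p.eval (x : ℂ)) * (1 - x ^ 2 / a ^ 2) ^ (v - 1))
      volume (-a) a :=
    (intervalIntegrable_weight a hv).continuousOn_mul
      (Complex.continuous_normSq.comp
        (p.continuous.comp Complex.continuous_ofReal)).continuousOn
  rw [intervalIntegrable_iff_integrableOn_Ioo_of_le hle] at hi
  rw [intervalIntegral.integral_of_le hle, integral_Ioc_eq_integral_Ioo,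
    setIntegral_eq_zero_iff_of_nonneg_ae
      (ae_restrict_of_forall_mem measurableSet_Ioo fun x hx =>
        normSq_mul_weight_nonneg p _ (Set.Ioo_subset_Icc_self hx)) hi] at h
  rw [Filter.EventuallyEq, ae_restrict_iff' measurableSet_Ioo] at h
  by_contra hp
  have hfin : {x : ℝ | p.eval (x : ℂ) = 0}.Finite :=
    (Polynomial.finite_setOfPred_isRoot hp).preimage Complex.ofReal_injective.injOn
  -- Almost every point of the interval would be a root, but the roots form a null set; the interval
  -- would then be null too.
  have h0 : ∀ᵐ x : ℝ, x ∉ Set.Ioo (-a) a := by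
    filter_upwards [h, hfin.countable.ae_notMem volume] with x hx hx' hxa
    rcases mul_eq_zero.mp (hx hxa) with h1 | h1
    · exact hx' (Complex.normSq_eq_zero.mp h1)
    · exact (Real.rpow_pos_of_pos (one_sub_sq_div_sq_pos hxa) _).ne' h1
  have h1 : volume (Set.Ioo (-a) a) = 0 := by
    simpa using measure_eq_zero_iff_ae_notMem.mpr h0
  rw [Real.volume_Ioo, ENNReal.ofReal_eq_zero] at h1
  linarith

/-- The pairing `weightPairing` as an inner product on `ℂ[X]`, linear in the second argument. -/
noncomputable abbrev weightCore (n : ℕ) {a : ℝ} (ha : 0 < a) : InnerProductSpace.Core ℂ ℂ[X] where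
  inner q p := weightPairing (n + 2) a p q
  conj_inner_symm p q := conj_weightPairing _ _ _ _
  re_inner_nonneg p := by
    rw [weightPairing_self]
    exact mul_nonneg (sphereArea_ratio_pos _ _ ha).le (integral_normSq_mul_weight_nonneg p _ ha)
  add_left p q r := weightPairing_add_right n a r p q
  smul_left p q c := weightPairing_smul_right _ a q p c
  definite p hp := by
    rw [weightPairing_self, Complex.ofReal_eq_zero] at hp
    have h := (mul_eq_zero.mp hp).resolve_left (sphereArea_ratio_pos _ _ ha).ne'
    rw [show ((n + 2 : ℕ) - 3 : ℝ) / 2 = ((n : ℝ) + 1) / 2 - 1 by push_cast; ring] at h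
    exact eq_zero_of_integral_normSq_mul_weight_eq_zero ha (by positivity) h

/-- A zonal polynomial of degree `m` is orthogonal to the lower powers of the variable. -/
theorem IsZonalPolynomial.weightPairing_X_pow {n m k : ℕ} {a : ℝ} (ha : 0 < a) {q : ℂ[X]}
    (hq : IsZonalPolynomial (n + 2) a m q) (hk : k < m) :
    weightPairing (n + 2) a q (Polynomial.X ^ k) = 0 := by
  obtain ⟨-, -, h, ⟨hL, hr⟩, hh⟩ := hq
  have hG := gaussIntegral_harmonic_mul_X_pow 0 k m h hk hh hL
  rw [gaussIntegral_eq_integral_sphere (hh.mul (MvPolynomial.isHomogeneous_X_pow 0 k))] at hG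
  have hΓ : Real.Gamma (((m + k : ℕ) + (n + 2 : ℕ)) / 2) / 2 ≠ 0 :=
    (half_pos (Real.Gamma_pos_of_pos (by positivity))).ne'
  have h0 := (mul_eq_zero.mp hG).resolve_right (by exact_mod_cast hΓ)
  rw [← spherePairing_eq_weightPairing n ha, spherePairing,
    integral_uniformSphere (n + 1) a (f := fun x => evalReal (inFirstVariable (n + 2) q) x *
      conj (evalReal (inFirstVariable (n + 2) (Polynomial.X ^ k)) x))
      ((continuous_evalReal _).mul (Complex.continuous_conj.comp (continuous_evalReal _)))]
  -- On the sphere of radius a, q(x_1) may be replaced by h, and conjugation does nothing to the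
  -- real x_1^k; homogeneity then rescales to the unit sphere.
  have he (x : Metric.sphere (0 : EuclideanSpace ℝ (Fin (n + 2))) 1) :
      evalReal (inFirstVariable (n + 2) q) (a • x.1) *
        conj (evalReal (inFirstVariable (n + 2) (Polynomial.X ^ k)) (a • x.1)) =
      (a : ℂ) ^ (m + k) * evalReal (h * MvPolynomial.X 0 ^ k) x := by
    have hx : a • x.1 ∈ Metric.sphere (0 : EuclideanSpace ℝ (Fin (n + 2))) a := by
      simp [norm_smul, abs_of_pos ha]
    rw [← hr _ hx, evalReal_smul_of_isHomogeneous hh, evalReal_mul, evalReal_inFirstVariable]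
    simp [evalReal]
    ring
  simp only [he, integral_const_mul, h0, mul_zero]

end Pairing

theorem propositionP (N : ℕ) [NeZero N] (hN : 2 ≤ N) (a : ℝ) (ha : 0 < a) :
    (∀ p q : ℂ[X],
      spherePairing a (inFirstVariable N p) (inFirstVariable N q) = weightPairing N a p q) ∧
    ∃ c : InnerProductSpace.Core ℂ ℂ[X],
      -- the inner product `c` is the pairing; Mathlib's convention is linear on the right
      (∀ p q : ℂ[X], c.inner q p = weightPairing N a p q) ∧
      ∀ (m : ℕ) (q : ℂ[X]),
        IsZonalPolynomial N a m q ↔ q = gramSchmidtOf c (fun k => Polynomial.X ^ k) m := by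
  -- With N = n + 2 the exponent (N - 3)/2 is v - 1 for v = (n + 1)/2 > 0, the integrable range,
  -- which includes the singular case N = 2.
  obtain ⟨n, rfl⟩ := Nat.exists_eq_add_of_le' hN
  have hz (m : ℕ) (q : ℂ[X]) (hq : IsZonalPolynomial (n + 2) a m q) :
      q = gramSchmidtOf (weightCore n ha) (fun k => Polynomial.X ^ k) m :=
    eq_gramSchmidtOf _ _ _ _ (hq.1.sub_X_pow_mem_span hq.2.1)
      fun k hk => hq.weightPairing_X_pow ha hk
  refine ⟨spherePairing_eq_weightPairing n ha, weightCore n ha, fun p q => rfl,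
    fun m q => ⟨hz m q, ?_⟩⟩
  rintro rfl
  -- Some zonal polynomial exists, and by `hz` it is the Gram–Schmidt vector.
  obtain ⟨q, hq⟩ := exists_isZonalPolynomial (n + 2) a m
  rwa [← hz m q hq]
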